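/- Let $r>1$ and $\rho>0$. Let $\mathcal P_{r,\rho}$ be the set of functions $p:(0,\infty)\to(0,\infty)$ that are bounded and right-continuous, with $\inf_{x\in[1,r]}p(x)>0$ and $p(xr)=p(x)$ for all $x>0$, and such that $x\mapsto x^{\rho}p(x)$ is nondecreasing on $(0,\infty)$. Let $\mathcal Q_{r,\rho}$ be the set of functions $q:(0,\infty)\to(0,\infty)$ with $q(sr)=q(s)$ for all $s>0$ such that $f(s)=s^{-\rho}q(s)$ is completely monotone on $(0,\infty)$, i.e. $f$ is infinitely differentiable and $(-1)^n f^{(n)}(s)\ge 0$ for all integers $n\ge 0$ and all $s>0$. For $p\in\mathcal P_{r,\rho}$ put $$\mathrm A_\rho p(s)=s^{\rho}\int_0^\infty e^{-sx}\,\mathrm d\big(x^{\rho}p(x)\big),\qquad s>0,$$ a Lebesgue--Stieltjes integral over $[0,\infty)$ in which $x^\rho p(x)$ is given the value $0$ for $x\le 0$. Then this integral is finite for every $p\in\mathcal P_{r,\rho}$ and $s>0$, and $\mathrm A_\rho$ is a bijection from $\mathcal P_{r,\rho}$ onto $\mathcal Q_{r,\rho}$. -/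

import Mathlib

open Set MeasureTheory Filter Topology
open scoped ContDiff

namespace LogPeriodic

noncomputable section

/-- The half-line `(0, ∞)`. -/
abbrev PosReal : Type := {x : ℝ // 0 < x}

/-- The extension of a function on `(0, ∞)` to `ℝ` by the value `0` on `(-∞, 0]`. -/
def extendZero (f : PosReal → ℝ) (x : ℝ) : ℝ :=
  if h : 0 < x then f ⟨x, h⟩ else 0

/-- `p (x r) = p x` for all `x > 0`. -/
def IsLogPeriodic (r : ℝ) (p : PosReal → ℝ) : Prop :=
  ∀ x y : PosReal, (y : ℝ) = x * r → p y = p x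

/-- The class `𝒫_r`: functions `p : (0, ∞) → (0, ∞)` with `inf_{[1, r]} p > 0` that are bounded,
right-continuous and satisfy `p (x r) = p x`. -/
structure MemP (r : ℝ) (p : PosReal → ℝ) : Prop where
  pos : ∀ x, 0 < p x
  inf_pos : ∃ c : ℝ, 0 < c ∧ ∀ x : PosReal, (x : ℝ) ∈ Icc 1 r → c ≤ p x
  bounded : ∃ M : ℝ, ∀ x, p x ≤ M
  right_cont : ∀ x, ContinuousWithinAt p (Ici x) x
  periodic : IsLogPeriodic r p

/-- The class `𝒫_{r,ρ}`: those `p ∈ 𝒫_r` for which `x ↦ x ^ ρ * p x` is nondecreasing on `(0, ∞)`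
if `ρ ≥ 0`, and nonincreasing if `ρ < 0`. -/
def classP (r ρ : ℝ) : Set (PosReal → ℝ) :=
  {p | MemP r p ∧
    (0 ≤ ρ → Monotone fun x : PosReal => (x : ℝ) ^ ρ * p x) ∧
    (ρ < 0 → Antitone fun x : PosReal => (x : ℝ) ^ ρ * p x)}

/-- Complete monotonicity on `(0, ∞)`: smooth, with `(-1) ^ n f⁽ⁿ⁾ ≥ 0` for every `n ≥ 0`.
Only the values of `f` on `(0, ∞)` matter. -/
def CompletelyMonotone (f : ℝ → ℝ) : Prop :=
  ContDiffOn ℝ ∞ f (Ioi 0) ∧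
    ∀ (n : ℕ) (s : ℝ), 0 < s → 0 ≤ (-1 : ℝ) ^ n * iteratedDerivWithin n f (Ioi 0) s

/-- The class `𝒬_{r,ρ}`: functions `q : (0, ∞) → (0, ∞)` such that `s ↦ s ^ (-ρ) * q s` is
completely monotone and `q (s r) = q s`. -/
def classQ (r ρ : ℝ) : Set (PosReal → ℝ) :=
  {q | (∀ s, 0 < q s) ∧ CompletelyMonotone (fun s => s ^ (-ρ) * extendZero q s) ∧
    IsLogPeriodic r q}

/-- The function `x ↦ x ^ ρ * p x` on `(0, ∞)`, extended by `0` to `(-∞, 0]`. -/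
def powMul (ρ : ℝ) (p : PosReal → ℝ) (x : ℝ) : ℝ :=
  x ^ ρ * extendZero p x

open Classical in
/-- The Lebesgue–Stieltjes measure `dG` of a nondecreasing function `G : ℝ → ℝ`, which satisfies
`dG (a, b] = G (b+) - G (a+)`. (Zero by convention if `G` is not nondecreasing.) -/
def lsMeasure (G : ℝ → ℝ) : Measure ℝ :=
  if h : Monotone G then h.stieltjesFunction.measure else 0

/-- The operator `A_ρ p (s) = s ^ ρ * ∫_{[0, ∞)} e ^ (-s x) d(x ^ ρ p(x))`, for `s > 0`. -/
def opA (ρ : ℝ) (p : PosReal → ℝ) (s : PosReal) : ℝ :=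
  (s : ℝ) ^ ρ * ∫ x in Ici (0 : ℝ), Real.exp (-(s : ℝ) * x) ∂(lsMeasure (powMul ρ p))

lemma extendZero_of_pos (f : PosReal → ℝ) {x : ℝ} (h : 0 < x) : extendZero f x = f ⟨x, h⟩ :=
  dif_pos h

lemma powMul_of_nonpos (ρ : ℝ) (p : PosReal → ℝ) {x : ℝ} (h : x ≤ 0) : powMul ρ p x = 0 := by
  simp [powMul, extendZero, not_lt.2 h]

/-- For `p ∈ 𝒫_{r,ρ}`, `ρ ≥ 0`, the function `powMul ρ p` is nondecreasing on all of `ℝ`, so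
that `lsMeasure (powMul ρ p)` is a genuine Stieltjes measure. -/
lemma monotone_powMul {r ρ : ℝ} (hρ : 0 ≤ ρ) {p : PosReal → ℝ} (hp : p ∈ classP r ρ) :
    Monotone (powMul ρ p) := by
  intro x y hxy
  rcases le_or_gt x 0 with hx | hx
  · rw [powMul_of_nonpos ρ p hx]
    rcases le_or_gt y 0 with hy | hy
    · rw [powMul_of_nonpos ρ p hy]
    · rw [powMul, extendZero_of_pos p hy]
      exact mul_nonneg (Real.rpow_nonneg hy.le _) (hp.1.pos _).le
  · have hy : 0 < y := hx.trans_le hxy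
    rw [powMul, powMul, extendZero_of_pos p hx, extendZero_of_pos p hy]
    exact hp.2.1 hρ (show (⟨x, hx⟩ : PosReal) ≤ ⟨y, hy⟩ from hxy)

end

end LogPeriodic

/-! The operator is a Laplace transform: `powMul ρ p` is the distribution function of a measure `μ`
on `[0, ∞)`, and `opA ρ p s` is `s ^ ρ` times the transform of `μ` at `s`. Log-periodicity of `p`
says that `μ` equals `r ^ ρ` times its image under `x ↦ x * r`; on transforms this is
log-periodicity of `q`. The claim thus reduces to Bernstein's theorem together with uniqueness of
Laplace transforms, both proved here.

Finiteness follows from the growth `x ^ ρ` of the distribution function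
(`laplace_ne_top_of_polynomial_growth`), and differentiation under the integral gives complete
monotonicity. Injectivity is `ext_of_laplace_eq`: the substitution `y = exp (-x)` turns uniqueness
into the moment problem on `[0, 1]`, settled by Weierstrass approximation.

For surjectivity, Taylor series of a completely monotone `f` about far away points yield discrete
measures on `[0, 1]`; a weak limit represents `f` on `(1, ∞)` (`exists_laplace_eq`). Uniqueness
makes the representing measure homogeneous, and homogeneity carries the representation down to all
`s > 0`. Then `p x = x ^ (-ρ) * μ (Iic x)` is the preimage. -/

namespace LogPeriodic

open scoped ENNReal NNReal Nat

/-! ### Taylor expansion of completely monotone functions -/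

namespace CompletelyMonotone

variable {f : ℝ → ℝ}

lemma iteratedDerivWithin_uIcc (hf : CompletelyMonotone f) {a b t : ℝ} (ha : 0 < a) (hb : 0 < b)
    (hab : a ≠ b) (ht : t ∈ uIcc a b) (n : ℕ) :
    iteratedDerivWithin n f (uIcc a b) t = iteratedDerivWithin n f (Ioi 0) t := by
  have ht0 : t ∈ Ioi (0 : ℝ) := (lt_min ha hb).trans_le ht.1
  rw [iteratedDerivWithin_of_isOpen isOpen_Ioi ht0]
  refine iteratedDerivWithin_eq_iteratedDeriv (uniqueDiffOn_uIcc hab) ?_ ht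
  exact (hf.1.contDiffAt (Ioi_mem_nhds ht0)).of_le (mod_cast le_top)

lemma continuousOn_iteratedDerivWithin (hf : CompletelyMonotone f) (n : ℕ) :
    ContinuousOn (iteratedDerivWithin n f (Ioi 0)) (Ioi 0) :=
  hf.1.continuousOn_iteratedDerivWithin (mod_cast le_top) isOpen_Ioi.uniqueDiffOn

lemma sub_taylor_eq (hf : CompletelyMonotone f) {s a : ℝ} (hs : 0 < s) (hsa : s < a) (n : ℕ) :
    f s - ∑ k ∈ Finset.range (n + 1),
        (-1 : ℝ) ^ k * iteratedDerivWithin k f (Ioi 0) a / k ! * (a - s) ^ k =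
      ∫ t in s..a, (t - s) ^ n / n ! *
        ((-1 : ℝ) ^ (n + 1) * iteratedDerivWithin (n + 1) f (Ioi 0) t) := by
  have ha := hs.trans hsa
  have hsub : uIcc a s ⊆ Ioi (0 : ℝ) := fun t ht => (lt_min ha hs).trans_le ht.1
  have hsm : ContDiffOn ℝ (n + 1 : ℕ) f (uIcc a s) := (hf.1.mono hsub).of_le (mod_cast le_top)
  have h := taylor_integral_remainder hsm
  rw [taylor_within_apply, intervalIntegral.integral_symm, ← intervalIntegral.integral_neg] at h
  have hl : ∑ k ∈ Finset.range (n + 1),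
      (-1 : ℝ) ^ k * iteratedDerivWithin k f (Ioi 0) a / k ! * (a - s) ^ k =
      ∑ k ∈ Finset.range (n + 1),
        ((k ! : ℝ)⁻¹ * (s - a) ^ k) • iteratedDerivWithin k f (uIcc a s) a := by
    refine Finset.sum_congr rfl fun k _ => ?_
    rw [hf.iteratedDerivWithin_uIcc ha hs hsa.ne' left_mem_uIcc, smul_eq_mul,
      show s - a = (-1) * (a - s) by ring, mul_pow]
    ring
  rw [hl, h]
  · refine intervalIntegral.integral_congr fun t ht => ?_
    rw [uIcc_comm] at ht
    simp only [hf.iteratedDerivWithin_uIcc ha hs hsa.ne' ht, smul_eq_mul]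
    rw [show s - t = (-1) * (t - s) by ring, mul_pow]
    ring

lemma taylor_remainder_intervalIntegrable (hf : CompletelyMonotone f) {c s a : ℝ} (hs : 0 < s)
    (hsa : s ≤ a) (n : ℕ) :
    IntervalIntegrable (fun t => (t - c) ^ n / n ! *
      ((-1 : ℝ) ^ (n + 1) * iteratedDerivWithin (n + 1) f (Ioi 0) t)) volume s a := by
  refine ContinuousOn.intervalIntegrable ?_
  have hsub : uIcc s a ⊆ Ioi (0 : ℝ) := by
    rw [uIcc_of_le hsa]; exact fun t ht => hs.trans_le ht.1
  refine ContinuousOn.mul (by fun_prop) (continuousOn_const.mul ?_)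
  exact (hf.continuousOn_iteratedDerivWithin _).mono hsub

/-- All terms and the integral remainder are nonnegative for expansion to the left of `a`. Moving
the base of the remainder from `s` to some `c < s` gains a factor `θ ^ n` with `θ < 1`, while the
remainder at `c` is at most `f c`. -/
lemma hasSum_taylor (hf : CompletelyMonotone f) {s a : ℝ} (hs : 0 < s) (hsa : s ≤ a) :
    HasSum (fun k : ℕ =>
      (-1 : ℝ) ^ k * iteratedDerivWithin k f (Ioi 0) a / k ! * (a - s) ^ k) (f s) := by
  have ha := hs.trans_le hsa
  rcases hsa.eq_or_lt with rfl | hsa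
  · convert hasSum_single (f := fun k : ℕ =>
      (-1 : ℝ) ^ k * iteratedDerivWithin k f (Ioi 0) s / k ! * (s - s) ^ k) 0 ?_ using 1
    · simp
    · intro k hk
      simp [hk]
  have hnn (s' : ℝ) (hs' : s' ≤ a) (k : ℕ) :
      0 ≤ (-1 : ℝ) ^ k * iteratedDerivWithin k f (Ioi 0) a / k ! * (a - s') ^ k :=
    mul_nonneg (div_nonneg (hf.2 k a ha) (by positivity)) (pow_nonneg (sub_nonneg.2 hs') _)
  rw [hasSum_iff_tendsto_nat_of_nonneg (hnn s hsa.le), ← tendsto_add_atTop_iff_nat 1]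
  -- Any `c` in `(0, s)` would do; `θ` is the maximum of `(t - s) / (t - c)` over `t ∈ [s, a]`,
  -- attained at `t = a`.
  set c := s / 2 with hc
  have hc0 : 0 < c := by positivity
  have hcs : c < s := by linarith
  set θ := (a - s) / (a - c) with hθ
  have hac : 0 < a - c := by linarith
  have hθ0 : 0 ≤ θ := div_nonneg (by linarith) hac.le
  have hθ1 : θ < 1 := (div_lt_one hac).2 (by linarith)
  have hbound (n : ℕ) : ∫ t in s..a, (t - s) ^ n / n ! *
        ((-1 : ℝ) ^ (n + 1) * iteratedDerivWithin (n + 1) f (Ioi 0) t) ≤ θ ^ n * f c := by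
    calc _ ≤ ∫ t in s..a, θ ^ n * ((t - c) ^ n / n ! *
        ((-1 : ℝ) ^ (n + 1) * iteratedDerivWithin (n + 1) f (Ioi 0) t)) := by
          refine intervalIntegral.integral_mono_on hsa.le
            (hf.taylor_remainder_intervalIntegrable hs hsa.le n)
            ((hf.taylor_remainder_intervalIntegrable hs hsa.le n).const_mul _) fun t ht => ?_
          rw [← mul_assoc (θ ^ n), ← mul_div_assoc, ← mul_pow]
          refine mul_le_mul_of_nonneg_right ?_ (hf.2 _ t (hs.trans_le ht.1))
          refine div_le_div_of_nonneg_right (pow_le_pow_left₀ (sub_nonneg.2 ht.1) ?_ n)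
            (by positivity)
          rw [hθ, div_mul_eq_mul_div, le_div_iff₀ hac]
          nlinarith [mul_nonneg (sub_nonneg.2 ht.2) (sub_nonneg.2 hcs.le)]
      _ = θ ^ n * ∫ t in s..a, (t - c) ^ n / n ! *
        ((-1 : ℝ) ^ (n + 1) * iteratedDerivWithin (n + 1) f (Ioi 0) t) := by
          rw [intervalIntegral.integral_const_mul]
      _ ≤ θ ^ n * ∫ t in c..a, (t - c) ^ n / n ! *
        ((-1 : ℝ) ^ (n + 1) * iteratedDerivWithin (n + 1) f (Ioi 0) t) := by
          refine mul_le_mul_of_nonneg_left ?_ (pow_nonneg hθ0 n)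
          refine intervalIntegral.integral_mono_interval hcs.le hsa.le le_rfl ?_
            (hf.taylor_remainder_intervalIntegrable hc0 (hcs.trans hsa).le n)
          refine (ae_restrict_iff' measurableSet_Ioc).2 (.of_forall fun t ht => ?_)
          exact mul_nonneg (div_nonneg (pow_nonneg (sub_nonneg.2 ht.1.le) _) (by positivity))
            (hf.2 _ t (hc0.trans ht.1))
      _ ≤ θ ^ n * f c := by
          refine mul_le_mul_of_nonneg_left ?_ (pow_nonneg hθ0 n)
          rw [← hf.sub_taylor_eq hc0 (hcs.trans hsa) n]
          exact sub_le_self _ (Finset.sum_nonneg fun k _ => hnn c (hcs.trans hsa).le k)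
  have hlim : Tendsto (fun n : ℕ => f s - θ ^ n * f c) atTop (𝓝 (f s)) := by
    simpa using tendsto_const_nhds.sub
      ((tendsto_pow_atTop_nhds_zero_of_lt_one hθ0 hθ1).mul_const (f c))
  refine tendsto_of_tendsto_of_tendsto_of_le_of_le hlim tendsto_const_nhds (fun n => ?_)
    fun n => ?_
  · have := hf.sub_taylor_eq hs hsa n
    have := hbound n
    simp only
    linarith
  · have h1 := hf.sub_taylor_eq hs hsa n
    have : 0 ≤ ∫ t in s..a, (t - s) ^ n / n ! *
        ((-1 : ℝ) ^ (n + 1) * iteratedDerivWithin (n + 1) f (Ioi 0) t) :=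
      intervalIntegral.integral_nonneg hsa.le fun t ht =>
        mul_nonneg (div_nonneg (pow_nonneg (sub_nonneg.2 ht.1) _) (by positivity))
          (hf.2 _ t (hs.trans_le ht.1))
    simp only
    linarith

end CompletelyMonotone

/-! ### Uniqueness of Laplace transforms -/

/-- The Laplace transform of a measure on `ℝ`. -/
noncomputable def laplace (μ : Measure ℝ) (s : ℝ) : ℝ≥0∞ :=
  ∫⁻ x, ENNReal.ofReal (Real.exp (-s * x)) ∂μ

/-- Polynomials are uniformly dense in the continuous functions on `[0, 1]`, so the moments fix the
integrals of all bounded continuous functions. -/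
lemma ext_of_forall_pow_integral_eq {μ ν : Measure ℝ} [IsFiniteMeasure μ] [IsFiniteMeasure ν]
    (hμ : ∀ᵐ x ∂μ, x ∈ Icc (0 : ℝ) 1) (hν : ∀ᵐ x ∂ν, x ∈ Icc (0 : ℝ) 1)
    (h : ∀ n : ℕ, ∫ x, x ^ n ∂μ = ∫ x, x ^ n ∂ν) : μ = ν := by
  have hint {μ : Measure ℝ} [IsFiniteMeasure μ] (hμ : ∀ᵐ x ∂μ, x ∈ Icc (0 : ℝ) 1) (n : ℕ) :
      Integrable (fun x : ℝ => x ^ n) μ := by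
    refine Integrable.of_bound (by fun_prop) 1 (hμ.mono fun x hx => ?_)
    rw [norm_pow, Real.norm_of_nonneg hx.1]
    exact pow_le_one₀ hx.1 hx.2
  have hpint {μ : Measure ℝ} [IsFiniteMeasure μ] (hμ : ∀ᵐ x ∂μ, x ∈ Icc (0 : ℝ) 1)
      (p : Polynomial ℝ) : Integrable (fun x : ℝ => p.eval x) μ := by
    simp only [Polynomial.eval_eq_sum_range]
    exact integrable_finsetSum _ fun i _ => (hint hμ i).const_mul _
  have hpoly (p : Polynomial ℝ) : ∫ x, p.eval x ∂μ = ∫ x, p.eval x ∂ν := by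
    simp only [Polynomial.eval_eq_sum_range]
    rw [integral_finsetSum _ fun i _ => (hint hμ i).const_mul _,
      integral_finsetSum _ fun i _ => (hint hν i).const_mul _]
    simp only [integral_const_mul, h]
  refine ext_of_forall_integral_eq_of_IsFiniteMeasure fun g => ?_
  have hbd {μ : Measure ℝ} [IsFiniteMeasure μ] (hμ : ∀ᵐ x ∂μ, x ∈ Icc (0 : ℝ) 1)
      (p : Polynomial ℝ) {ε : ℝ} (hp : ∀ x ∈ Icc (0 : ℝ) 1, |p.eval x - g x| < ε) :
      |∫ x, p.eval x ∂μ - ∫ x, g x ∂μ| ≤ ε * μ.real univ := by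
    rw [← integral_sub (hpint hμ p) (g.integrable μ), ← Real.norm_eq_abs]
    exact norm_integral_le_of_norm_le_const (hμ.mono fun x hx => (hp x hx).le)
  refine eq_of_abs_sub_le_all fun ε hε => ?_
  set M := μ.real univ + ν.real univ + 1
  have hM : 0 < M := by positivity
  obtain ⟨p, hp⟩ := exists_polynomial_near_of_continuousOn 0 1 g g.continuous.continuousOn
    (ε / M) (by positivity)
  have h1 := hbd hμ p hp
  have h2 := hbd hν p hp
  rw [hpoly p] at h1
  have h3 : ε / M * μ.real univ + ε / M * ν.real univ ≤ ε := by
    rw [← mul_add, div_mul_eq_mul_div, div_le_iff₀ hM]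
    exact mul_le_mul_of_nonneg_left (by simp [M]) hε.le
  rw [abs_le] at *
  constructor <;> linarith [h1.1, h1.2, h2.1, h2.2]

/-- A measure on `[0, ∞)` is determined by its Laplace transform near infinity. -/
lemma ext_of_laplace_eq {μ ν : Measure ℝ} (hμ : μ (Iio 0) = 0) (hν : ν (Iio 0) = 0) {s₀ : ℝ}
    (hfin : ∀ s, s₀ < s → laplace μ s ≠ ⊤) (h : ∀ s, s₀ < s → laplace μ s = laplace ν s) :
    μ = ν := by
  -- The weight `exp (-c * x)` makes both measures finite; after `y = exp (-x)` the `n`-th moment is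
  -- the Laplace transform at `c + n`.
  set c := s₀ + 1
  set w : ℝ → ℝ≥0∞ := fun x => ENNReal.ofReal (Real.exp (-c * x)) with hw
  have hwm : Measurable w := by fun_prop
  have he : Measurable fun x : ℝ => Real.exp (-x) := by fun_prop
  have hfin' : ∀ s, s₀ < s → laplace ν s ≠ ⊤ := fun s hs => h s hs ▸ hfin s hs
  -- Nothing is lost in passing to `[0, 1]`: the weight is positive and finite, and `-log` inverts
  -- `exp (-x)`.
  have hcan (μ : Measure ℝ) : (((μ.withDensity w).map (fun x => Real.exp (-x))).map
      (fun y => -Real.log y)).withDensity (fun x => (w x)⁻¹) = μ := by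
    rw [Measure.map_map (by fun_prop) he]
    have : (fun y => -Real.log y) ∘ (fun x => Real.exp (-x)) = id := by ext x; simp
    rw [this, Measure.map_id]
    exact withDensity_inv_same hwm (.of_forall fun x => by simp [w, Real.exp_pos])
      (.of_forall fun x => by simp [w])
  have hF (μ : Measure ℝ) (hfin : ∀ s, s₀ < s → laplace μ s ≠ ⊤) :
      IsFiniteMeasure ((μ.withDensity w).map (fun x => Real.exp (-x))) := by
    have : IsFiniteMeasure (μ.withDensity w) :=
      isFiniteMeasure_withDensity (hfin c (by simp [c]))
    infer_instance
  have hsupp (μ : Measure ℝ) (hμ : μ (Iio 0) = 0) :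
      ∀ᵐ y ∂((μ.withDensity w).map (fun x => Real.exp (-x))), y ∈ Icc (0 : ℝ) 1 := by
    refine (ae_map_iff he.aemeasurable (p := fun y => y ∈ Icc (0 : ℝ) 1) measurableSet_Icc).2 ?_
    refine (withDensity_absolutelyContinuous μ w).ae_le ?_
    have : ∀ᵐ x ∂μ, ¬ x ∈ Iio (0 : ℝ) := measure_eq_zero_iff_ae_notMem.1 hμ
    filter_upwards [this] with x hx
    exact ⟨(Real.exp_pos _).le, by simpa using hx⟩
  have hmom (μ : Measure ℝ) (n : ℕ) :
      ∫ y, y ^ n ∂((μ.withDensity w).map (fun x => Real.exp (-x))) =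
        (laplace μ (c + n)).toReal := by
    rw [integral_map he.aemeasurable (by fun_prop),
      integral_eq_lintegral_of_nonneg_ae (.of_forall fun x => by positivity) (by fun_prop),
      lintegral_withDensity_eq_lintegral_mul _ hwm (by fun_prop)]
    congr 1
    refine lintegral_congr fun x => ?_
    simp only [Pi.mul_apply, hw]
    rw [← ENNReal.ofReal_mul (Real.exp_pos _).le, ← Real.exp_nat_mul, ← Real.exp_add]
    congr 2
    ring
  have := hF μ hfin
  have := hF ν hfin'
  rw [← hcan μ, ← hcan ν, ext_of_forall_pow_integral_eq (hsupp μ hμ) (hsupp ν hν) fun n => ?_]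
  rw [hmom, hmom, h _ (by simp only [c]; linarith [n.cast_nonneg (α := ℝ)])]

/-! ### Bernstein's theorem -/

/-- The function `y ↦ y ^ c` on `[0, 1]`, extended to `ℝ` by clamping. -/
noncomputable def clampPow (c : ℝ) (hc : 0 ≤ c) : BoundedContinuousFunction ℝ ℝ :=
  BoundedContinuousFunction.ofNormedAddCommGroup (fun y : ℝ => (max 0 (min y 1)) ^ c)
    ((Real.continuous_rpow_const hc).comp (by fun_prop)) 1 fun y => by
      have h0 : 0 ≤ max 0 (min y 1) := le_max_left _ _
      rw [Real.norm_of_nonneg (Real.rpow_nonneg h0 c)]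
      exact Real.rpow_le_one h0 (max_le zero_le_one (min_le_right _ _)) hc

lemma clampPow_apply (c : ℝ) (hc : 0 ≤ c) {y : ℝ} (hy : y ∈ Icc (0 : ℝ) 1) :
    clampPow c hc y = y ^ c := by
  simp [clampPow, hy.1, hy.2]

lemma clampPow_nonneg (c : ℝ) (hc : 0 ≤ c) (y : ℝ) : 0 ≤ clampPow c hc y :=
  Real.rpow_nonneg (le_max_left _ _) _

lemma tendsto_mul_one_sub_exp_neg_div (c : ℝ) :
    Tendsto (fun n : ℕ => ((n : ℝ) + 1) * (1 - Real.exp (-c / (n + 1)))) atTop (𝓝 c) := by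
  have hd : HasDerivAt (fun x : ℝ => 1 - Real.exp (-c * x)) c 0 := by
    have := (((hasDerivAt_id (0 : ℝ)).const_mul (-c)).exp).const_sub 1
    simpa using this
  have ht := hasDerivAt_iff_tendsto_slope_zero.1 hd
  have hu : Tendsto (fun n : ℕ => 1 / ((n : ℝ) + 1)) atTop (𝓝[≠] 0) :=
    tendsto_nhdsWithin_iff.2 ⟨tendsto_one_div_add_atTop_nhds_zero_nat,
      .of_forall fun n => by simp; positivity⟩
  refine (ht.comp hu).congr fun n => ?_
  simp [div_eq_mul_inv]

namespace CompletelyMonotone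

variable {f : ℝ → ℝ}

/-- The Taylor terms of `f 1` about `1 + n` serve as masses at the points `exp (-k / n)`.
Integrating `y ^ c` replaces `n ^ k` by `(n * exp (-c / n)) ^ k`, which is the Taylor series at
another point, tending to `1 + c` as `n → ∞`. -/
lemma exists_finiteMeasure_approx (hf : CompletelyMonotone f) {n : ℝ} (hn : 0 < n) :
    ∃ ν : FiniteMeasure ℝ, ν.mass ≤ (f 1).toNNReal ∧ ν (Icc 0 1)ᶜ = 0 ∧
      ∀ (c : ℝ) (hc : 0 ≤ c),
        ∫ y, clampPow c hc y ∂(ν : Measure ℝ) = f (1 + n * (1 - Real.exp (-c / n))) := by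
  set w : ℕ → ℝ := fun k =>
    (-1 : ℝ) ^ k * iteratedDerivWithin k f (Ioi 0) (1 + n) / k ! * n ^ k with hw
  have hw0 (k : ℕ) : 0 ≤ w k :=
    mul_nonneg (div_nonneg (hf.2 k _ (by positivity)) (by positivity)) (by positivity)
  have hws : HasSum w (f 1) := by
    simpa using hf.hasSum_taylor one_pos (show (1 : ℝ) ≤ 1 + n by linarith)
  set pt : ℕ → ℝ := fun k => Real.exp (-k / n) with hpt
  have hpt1 (k : ℕ) : pt k ∈ Icc (0 : ℝ) 1 := by
    refine ⟨(Real.exp_pos _).le, Real.exp_le_one_iff.2 ?_⟩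
    rw [neg_div]
    exact neg_nonpos.2 (by positivity)
  set m : Measure ℝ := Measure.sum fun k => ENNReal.ofReal (w k) • Measure.dirac (pt k) with hm
  have hmu : m univ = ENNReal.ofReal (f 1) := by
    rw [hm, Measure.sum_apply _ MeasurableSet.univ, ← hws.tsum_eq,
      ENNReal.ofReal_tsum_of_nonneg hw0 hws.summable]
    simp
  have hfin : IsFiniteMeasure m := ⟨by rw [hmu]; exact ENNReal.ofReal_lt_top⟩
  obtain ⟨ν, hν⟩ : ∃ ν : FiniteMeasure ℝ, (ν : Measure ℝ) = m := ⟨⟨m, hfin⟩, rfl⟩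
  refine ⟨ν, ?_, ?_, fun c hc => ?_⟩
  · rw [← ENNReal.coe_le_coe, FiniteMeasure.ennreal_mass, hν]
    exact hmu.le
  · rw [FiniteMeasure.null_iff_toMeasure_null, hν, hm, Measure.sum_apply _ measurableSet_Icc.compl]
    simp only [Measure.smul_apply, smul_eq_mul, ENNReal.tsum_eq_zero]
    intro k
    rw [Measure.dirac_apply' _ measurableSet_Icc.compl, indicator_of_notMem (by simpa using hpt1 k),
      mul_zero]
  · rw [hν]
    refine (hasSum_integral_measure ((clampPow c hc).integrable m)).unique ?_
    have hE : Real.exp (-c / n) ≤ 1 := by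
      rw [Real.exp_le_one_iff, neg_div]
      exact neg_nonpos.2 (by positivity)
    have hE0 := Real.exp_pos (-c / n)
    have := hf.hasSum_taylor (s := 1 + n * (1 - Real.exp (-c / n))) (a := 1 + n)
      (by nlinarith) (by nlinarith)
    refine Eq.mpr (congrArg (HasSum · _) (funext fun k => ?_)) this
    rw [integral_smul_measure, integral_dirac, ENNReal.toReal_ofReal (hw0 k),
      clampPow_apply _ _ (hpt1 k), smul_eq_mul, hw, hpt,
      show 1 + n - (1 + n * (1 - Real.exp (-c / n))) = n * Real.exp (-c / n) by ring, mul_pow,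
      ← Real.exp_mul, ← Real.exp_nat_mul, mul_assoc]
    congr 3
    ring

/-- The approximating measures have bounded mass on the compact set `[0, 1]`, so they have a weak
limit along a free ultrafilter. -/
lemma exists_finiteMeasure (hf : CompletelyMonotone f) :
    ∃ ν : FiniteMeasure ℝ, ν (Icc 0 1)ᶜ = 0 ∧
      ∀ (c : ℝ) (hc : 0 ≤ c), ∫ y, clampPow c hc y ∂(ν : Measure ℝ) = f (1 + c) := by
  choose ν hmass hsupp hint using fun n : ℕ =>
    hf.exists_finiteMeasure_approx (n := (n : ℝ) + 1) (by positivity)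
  have hK := isCompact_setOfPred_finiteMeasure_le_of_isCompact (E := ℝ) (f 1).toNNReal
    (isCompact_Icc (a := (0 : ℝ)) (b := 1))
  obtain ⟨ν₀, hν₀, hlim⟩ := isCompact_iff_ultrafilter_le_nhds.1 hK
    ((hyperfilter ℕ).map ν) (by
      rw [le_principal_iff]
      exact Filter.mem_map.2 (Filter.univ_mem' fun n => ⟨hmass n, hsupp n⟩))
  refine ⟨ν₀, hν₀.2, fun c hc => ?_⟩
  have h1 := FiniteMeasure.tendsto_iff_forall_integral_tendsto.1
    (show Tendsto ν (hyperfilter ℕ) (𝓝 ν₀) from hlim) (clampPow c hc)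
  simp only [hint] at h1
  refine tendsto_nhds_unique h1 (Tendsto.mono_left ?_ Nat.hyperfilter_le_atTop)
  have hcont : ContinuousAt f (1 + c) :=
    hf.1.continuousOn.continuousAt (Ioi_mem_nhds (by positivity))
  exact hcont.tendsto.comp ((tendsto_mul_one_sub_exp_neg_div c).const_add 1)

lemma exists_laplace_eq (hf : CompletelyMonotone f) :
    ∃ μ : Measure ℝ, μ (Iio 0) = 0 ∧ ∀ s, 1 < s → laplace μ s = ENNReal.ofReal (f s) := by
  obtain ⟨ν, hsupp, hν⟩ := hf.exists_finiteMeasure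
  rw [FiniteMeasure.null_iff_toMeasure_null] at hsupp
  have hm : Measurable fun y : ℝ => ENNReal.ofReal y⁻¹ := by fun_prop
  have hl : Measurable fun y : ℝ => -Real.log y := by fun_prop
  -- Under `x = -log y` the density `y⁻¹ = exp x` undoes the shift by `1`. A possible atom at `y =
  -- 0` corresponds to `x = ∞`; it is dropped, which is harmless because `0 ^ (s - 1) = 0` for `s >
  -- 1`.
  refine ⟨(((ν : Measure ℝ).restrict (Ioc 0 1)).withDensity fun y => ENNReal.ofReal y⁻¹).map
    fun y => -Real.log y, ?_, fun s hs => ?_⟩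
  · rw [Measure.map_apply hl measurableSet_Iio]
    refine withDensity_absolutelyContinuous _ _ ?_
    rw [Measure.restrict_apply (hl measurableSet_Iio)]
    refine (congrArg _ ?_).trans measure_empty
    ext y
    simp only [mem_inter_iff, mem_preimage, mem_Iio, mem_Ioc, mem_empty_iff_false, iff_false,
      not_and, Left.neg_neg_iff]
    intro h1 h2 h3
    exact absurd h1 (not_lt.2 (Real.log_nonpos h2.le h3))
  · have hs1 : 0 ≤ s - 1 := by linarith
    rw [laplace, lintegral_map (by fun_prop) hl, lintegral_withDensity_eq_lintegral_mul _ hm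
      (by fun_prop), ← lintegral_indicator measurableSet_Ioc,
      show f s = f (1 + (s - 1)) by ring_nf, ← hν _ hs1,
      ofReal_integral_eq_lintegral_ofReal ((clampPow _ hs1).integrable _)
        (.of_forall (clampPow_nonneg _ hs1))]
    refine lintegral_congr_ae ?_
    have : ∀ᵐ y ∂(ν : Measure ℝ), ¬ y ∈ (Icc (0 : ℝ) 1)ᶜ := measure_eq_zero_iff_ae_notMem.1 hsupp
    filter_upwards [this] with y hy
    rw [notMem_compl_iff] at hy
    rw [clampPow_apply _ _ hy]
    rcases hy.1.eq_or_lt with rfl | hy0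
    · rw [indicator_of_notMem (by simp), Real.zero_rpow (by linarith), ENNReal.ofReal_zero]
    · rw [indicator_of_mem (show y ∈ Ioc (0 : ℝ) 1 from ⟨hy0, hy.2⟩), Pi.mul_apply,
        ← ENNReal.ofReal_mul (by positivity), neg_mul_neg, mul_comm s, ← Real.rpow_def_of_pos hy0,
        Real.rpow_sub_one hy0.ne', div_eq_inv_mul]

end CompletelyMonotone

/-! ### Laplace transforms of measures on `[0, ∞)` -/

lemma ext_of_measure_Iic_eq {μ ν : Measure ℝ} (hfin : ∀ x, μ (Iic x) ≠ ⊤)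
    (h : ∀ x, μ (Iic x) = ν (Iic x)) : μ = ν := by
  refine Measure.ext_of_Ioc' μ ν (fun a b _ =>
    ((measure_mono Ioc_subset_Iic_self).trans_lt (hfin b).lt_top).ne) fun a b hab => ?_
  rw [← Iic_sdiff_Iic, measure_sdiff (Iic_subset_Iic.2 hab.le) measurableSet_Iic.nullMeasurableSet
      (hfin a), measure_sdiff (Iic_subset_Iic.2 hab.le) measurableSet_Iic.nullMeasurableSet
      (h a ▸ hfin a), h, h]

lemma ae_nonneg_of_measure_Iio {μ : Measure ℝ} (hμ : μ (Iio 0) = 0) : ∀ᵐ x ∂μ, 0 ≤ x :=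
  (measure_eq_zero_iff_ae_notMem.1 hμ).mono fun _ hx => not_lt.1 hx

lemma laplace_smul_map_mul (μ : Measure ℝ) (k : ℝ≥0∞) (r s : ℝ) :
    laplace (k • μ.map (· * r)) s = k * laplace μ (s * r) := by
  rw [laplace, lintegral_smul_measure, lintegral_map (by fun_prop) (by fun_prop), laplace,
    smul_eq_mul]
  congr 2 with x
  ring_nf

lemma toReal_laplace (μ : Measure ℝ) (s : ℝ) :
    (laplace μ s).toReal = ∫ x, Real.exp (-s * x) ∂μ :=
  (integral_eq_lintegral_of_nonneg_ae (.of_forall fun _ => (Real.exp_pos _).le)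
    (by fun_prop)).symm

lemma integrable_exp_of_laplace_ne_top {μ : Measure ℝ} {s : ℝ} (h : laplace μ s ≠ ⊤) :
    Integrable (fun x => Real.exp (-s * x)) μ :=
  (lintegral_ofReal_ne_top_iff_integrable (by fun_prop)
    (.of_forall fun _ => (Real.exp_pos _).le)).1 h

lemma laplace_ne_zero {μ : Measure ℝ} (hμ : μ ≠ 0) (s : ℝ) : laplace μ s ≠ 0 := by
  intro h
  rw [laplace, lintegral_eq_zero_iff (by fun_prop)] at h
  refine hμ (ae_eq_bot.1 (eventually_false_iff_eq_bot.1 (h.mono fun x hx => ?_)))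
  exact (Real.exp_pos _).not_ge (ENNReal.ofReal_eq_zero.1 hx)

lemma laplace_ne_top_of_polynomial_growth {μ : Measure ℝ} (hμ : μ (Iio 0) = 0) {M : ℝ} (k : ℕ)
    (h : ∀ n : ℕ, μ (Iic ((n : ℝ) + 1)) ≤ ENNReal.ofReal (M * ((n : ℝ) + 1) ^ k))
    {s : ℝ} (hs : 0 < s) : laplace μ s ≠ ⊤ := by
  have hle : laplace μ s ≤
      ∑' n : ℕ, ENNReal.ofReal (Real.exp (-s * n)) * μ (Iic ((n : ℝ) + 1)) := by
    calc laplace μ s ≤ ∫⁻ x, ∑' n : ℕ, (Iic ((n : ℝ) + 1)).indicator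
          (fun _ => ENNReal.ofReal (Real.exp (-s * n))) x ∂μ := by
          refine lintegral_mono_ae ((ae_nonneg_of_measure_Iio hμ).mono fun x hx => ?_)
          -- The single term with index `⌊x⌋₊` already dominates `exp (-s * x)`.
          refine le_trans ?_ (ENNReal.le_tsum ⌊x⌋₊)
          rw [indicator_of_mem (show x ∈ Iic ((⌊x⌋₊ : ℝ) + 1) from (Nat.lt_floor_add_one x).le)]
          refine ENNReal.ofReal_le_ofReal (Real.exp_le_exp.2 ?_)
          nlinarith [Nat.floor_le hx]
      _ = _ := by
          rw [lintegral_tsum fun n => (measurable_const.indicator measurableSet_Iic).aemeasurable]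
          simp only [lintegral_indicator_const measurableSet_Iic]
  have hsum : Summable fun n : ℕ => Real.exp (-s * n) * (M * ((n : ℝ) + 1) ^ k) := by
    have := ((summable_nat_add_iff 1).2 (Real.summable_pow_mul_exp_neg_nat_mul k hs)).mul_left
      (M * Real.exp s)
    refine this.congr fun n => ?_
    push_cast
    rw [show -s * ((n : ℝ) + 1) = -s * n - s by ring, Real.exp_sub]
    field_simp
  refine ((hle.trans (ENNReal.tsum_le_tsum fun n => ?_)).trans_lt hsum.tsum_ofReal_lt_top).ne
  rw [ENNReal.ofReal_mul (Real.exp_pos _).le]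
  exact mul_le_mul_right (h n) _

lemma CompletelyMonotone.congr {f g : ℝ → ℝ} (hf : CompletelyMonotone f)
    (h : EqOn g f (Ioi 0)) : CompletelyMonotone g :=
  ⟨hf.1.congr h, fun n s hs => by
    rw [iteratedDerivWithin_congr h (show s ∈ Ioi (0 : ℝ) from hs)]; exact hf.2 n s hs⟩

open ProbabilityTheory in
lemma completelyMonotone_integral_exp {μ : Measure ℝ} (hμ : μ (Iio 0) = 0)
    (hfin : ∀ s, 0 < s → laplace μ s ≠ ⊤) :
    CompletelyMonotone fun s => ∫ x, Real.exp (-s * x) ∂μ := by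
  have hsub : Iio (0 : ℝ) ⊆ interior (integrableExpSet id μ) := by
    refine interior_maximal (fun t ht => ?_) isOpen_Iio
    simpa [integrableExpSet] using
      integrable_exp_of_laplace_ne_top (hfin (-t) (neg_pos.2 ht))
  have heq : (fun s => ∫ x, Real.exp (-s * x) ∂μ) = fun s => mgf id μ (-s) := rfl
  rw [heq]
  refine ⟨?_, fun n s hs => ?_⟩
  · have h1 : ContDiffOn ℝ ∞ (mgf id μ) (Iio 0) :=
      (analyticOn_mgf.mono hsub).contDiffOn isOpen_Iio.uniqueDiffOn
    exact h1.comp contDiff_neg.contDiffOn fun s hs =>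
      mem_Iio.2 (neg_neg_iff_pos.2 hs)
  · rw [iteratedDerivWithin_of_isOpen isOpen_Ioi (show s ∈ Ioi (0 : ℝ) from hs),
      iteratedDeriv_comp_neg, smul_eq_mul, ← mul_assoc, ← mul_pow, neg_one_mul, neg_neg, one_pow,
      one_mul, iteratedDeriv_mgf (hsub (neg_neg_iff_pos.2 hs))]
    refine integral_nonneg_of_ae ((ae_nonneg_of_measure_Iio hμ).mono fun x hx => ?_)
    exact mul_nonneg (pow_nonneg hx n) (Real.exp_pos _).le

/-! ### The Stieltjes measure attached to an element of `𝒫_{r,ρ}` -/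

lemma lsMeasure_Iic {G : ℝ → ℝ} (hG : Monotone G)
    (hrc : ∀ x, ContinuousWithinAt G (Ici x) x) (h0 : ∀ x ≤ 0, G x = 0) (x : ℝ) :
    lsMeasure G (Iic x) = ENNReal.ofReal (G x) := by
  have hval (x : ℝ) : hG.stieltjesFunction x = G x :=
    hG.continuousWithinAt_Ioi_iff_rightLim_eq.1 (continuousWithinAt_Ioi_iff_Ici.2 (hrc x))
  have hlim : Tendsto hG.stieltjesFunction atBot (𝓝 0) := by
    refine tendsto_const_nhds.congr' ?_
    filter_upwards [eventually_le_atBot 0] with x hx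
    rw [hval, h0 x hx]
  rw [lsMeasure, dif_pos hG, StieltjesFunction.measure_Iic _ hlim, hval, sub_zero]

lemma powMul_of_pos (ρ : ℝ) (p : PosReal → ℝ) {x : ℝ} (h : 0 < x) :
    powMul ρ p x = x ^ ρ * p ⟨x, h⟩ := by
  rw [powMul, extendZero_of_pos p h]

lemma powMul_mul {r ρ : ℝ} (hr : 0 < r) {p : PosReal → ℝ} (hp : IsLogPeriodic r p) (x : ℝ) :
    powMul ρ p (x * r) = r ^ ρ * powMul ρ p x := by
  rcases le_or_gt x 0 with hx | hx
  · rw [powMul_of_nonpos _ _ hx, powMul_of_nonpos _ _ (mul_nonpos_of_nonpos_of_nonneg hx hr.le),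
      mul_zero]
  · rw [powMul_of_pos _ _ hx, powMul_of_pos _ _ (mul_pos hx hr),
      hp ⟨x, hx⟩ ⟨x * r, mul_pos hx hr⟩ rfl, Real.mul_rpow hx.le hr.le]
    ring

section

variable {r ρ : ℝ} {p : PosReal → ℝ}

/-- At `0` the bound `p ≤ M` and `ρ > 0` squeeze the function to `0`, so the Stieltjes measure has
no atom there. -/
lemma continuousWithinAt_powMul (hρ : 0 < ρ) (hp : MemP r p) (x : ℝ) :
    ContinuousWithinAt (powMul ρ p) (Ici x) x := by
  rcases lt_trichotomy x 0 with hx | rfl | hx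
  · have : powMul ρ p =ᶠ[𝓝 x] fun _ => 0 :=
      mem_of_superset (Iio_mem_nhds hx) fun y hy => powMul_of_nonpos ρ p (le_of_lt hy)
    exact (continuousAt_const.congr this.symm).continuousWithinAt
  · obtain ⟨M, hM⟩ := hp.bounded
    have hlim : Tendsto (fun y : ℝ => y ^ ρ * M) (𝓝[≥] 0) (𝓝 0) := by
      have : ContinuousAt (fun y : ℝ => y ^ ρ * M) 0 :=
        ((Real.continuousAt_rpow_const 0 ρ (Or.inr hρ.le)).mul_const M)
      simpa [Real.zero_rpow hρ.ne'] using this.tendsto.mono_left nhdsWithin_le_nhds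
    rw [ContinuousWithinAt, powMul_of_nonpos ρ p le_rfl]
    refine tendsto_of_tendsto_of_tendsto_of_le_of_le' tendsto_const_nhds hlim ?_ ?_
    all_goals
      filter_upwards [self_mem_nhdsWithin] with y hy
      rcases (mem_Ici.1 hy).eq_or_lt with rfl | hy
    · exact (powMul_of_nonpos ρ p le_rfl).ge
    · rw [powMul_of_pos _ _ hy]
      exact mul_nonneg (Real.rpow_nonneg hy.le _) (hp.pos _).le
    · simp [powMul_of_nonpos ρ p le_rfl, Real.zero_rpow hρ.ne']
    · rw [powMul_of_pos _ _ hy]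
      exact mul_le_mul_of_nonneg_left (hM _) (Real.rpow_nonneg hy.le _)
  · refine ContinuousWithinAt.mul
      (Real.continuousAt_rpow_const x ρ (Or.inl hx.ne')).continuousWithinAt ?_
    have hemb : IsOpenEmbedding ((↑) : PosReal → ℝ) := isOpen_Ioi.isOpenEmbedding_subtypeVal
    have hmap := hemb.map_nhdsWithin_preimage_eq (Ici x) ⟨x, hx⟩
    have hext : extendZero p ∘ (↑) = p := funext fun y => extendZero_of_pos p y.2
    rw [ContinuousWithinAt, ← hmap, tendsto_map'_iff, hext, extendZero_of_pos p hx]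
    exact hp.right_cont ⟨x, hx⟩

lemma lsMeasure_powMul_Iic (hρ : 0 < ρ) (hp : p ∈ classP r ρ) (x : ℝ) :
    lsMeasure (powMul ρ p) (Iic x) = ENNReal.ofReal (powMul ρ p x) :=
  lsMeasure_Iic (monotone_powMul hρ.le hp) (continuousWithinAt_powMul hρ hp.1)
    (fun _ => powMul_of_nonpos ρ p) x

lemma lsMeasure_powMul_Iio_zero (hρ : 0 < ρ) (hp : p ∈ classP r ρ) :
    lsMeasure (powMul ρ p) (Iio 0) = 0 := by
  refine measure_mono_null Iio_subset_Iic_self ?_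
  rw [lsMeasure_powMul_Iic hρ hp, powMul_of_nonpos ρ p le_rfl, ENNReal.ofReal_zero]

lemma lsMeasure_powMul_ne_zero (hρ : 0 < ρ) (hp : p ∈ classP r ρ) :
    lsMeasure (powMul ρ p) ≠ 0 := by
  intro h
  have h1 := lsMeasure_powMul_Iic hρ hp 1
  rw [h, powMul_of_pos _ _ one_pos, Real.one_rpow, one_mul] at h1
  exact (hp.1.pos ⟨1, one_pos⟩).not_ge (ENNReal.ofReal_eq_zero.1 h1.symm)

lemma lsMeasure_powMul_eq_smul_map (hr : 0 < r) (hρ : 0 < ρ) (hp : p ∈ classP r ρ) :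
    lsMeasure (powMul ρ p) =
      ENNReal.ofReal (r ^ ρ) • (lsMeasure (powMul ρ p)).map (· * r) := by
  refine ext_of_measure_Iic_eq (fun x => ?_) fun x => ?_
  · rw [lsMeasure_powMul_Iic hρ hp]
    exact ENNReal.ofReal_ne_top
  · rw [Measure.smul_apply, Measure.map_apply (by fun_prop) measurableSet_Iic,
      show (· * r) ⁻¹' Iic x = Iic (x / r) by ext y; simp [le_div_iff₀ hr],
      lsMeasure_powMul_Iic hρ hp, lsMeasure_powMul_Iic hρ hp, smul_eq_mul,
      ← ENNReal.ofReal_mul (by positivity), ← powMul_mul hr hp.1.periodic,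
      div_mul_cancel₀ _ hr.ne']

lemma laplace_lsMeasure_powMul_ne_top (hρ : 0 < ρ) (hp : p ∈ classP r ρ) {s : ℝ} (hs : 0 < s) :
    laplace (lsMeasure (powMul ρ p)) s ≠ ⊤ := by
  obtain ⟨M, hM⟩ := hp.1.bounded
  have hM0 : 0 ≤ M := (hp.1.pos ⟨1, one_pos⟩).le.trans (hM _)
  refine laplace_ne_top_of_polynomial_growth (lsMeasure_powMul_Iio_zero hρ hp) (M := M) ⌈ρ⌉₊
    (fun n => ?_) hs
  have hn : (0 : ℝ) < n + 1 := by positivity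
  rw [lsMeasure_powMul_Iic hρ hp, powMul_of_pos _ _ hn, mul_comm]
  refine ENNReal.ofReal_le_ofReal (mul_le_mul (hM _) ?_ (by positivity) hM0)
  rw [← Real.rpow_natCast]
  exact Real.rpow_le_rpow_of_exponent_le (by simp) (Nat.le_ceil ρ)

lemma opA_eq (h : lsMeasure (powMul ρ p) (Iio 0) = 0) (s : PosReal) :
    opA ρ p s = (s : ℝ) ^ ρ * (laplace (lsMeasure (powMul ρ p)) s).toReal := by
  rw [opA, toReal_laplace, Measure.restrict_eq_self_of_ae_mem
    (s := Ici 0) (ae_nonneg_of_measure_Iio h)]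

lemma opA_mem_classQ (hr : 0 < r) (hρ : 0 < ρ) (hp : p ∈ classP r ρ) :
    opA ρ p ∈ classQ r ρ := by
  have h0 := lsMeasure_powMul_Iio_zero hρ hp
  have hfin := fun s hs => laplace_lsMeasure_powMul_ne_top hρ hp (s := s) hs
  refine ⟨fun s => ?_, ?_, fun s t hst => ?_⟩
  · rw [opA_eq h0]
    exact mul_pos (Real.rpow_pos_of_pos s.2 _) (ENNReal.toReal_pos
      (laplace_ne_zero (lsMeasure_powMul_ne_zero hρ hp) _) (hfin _ s.2))
  · refine (completelyMonotone_integral_exp h0 hfin).congr fun s hs => ?_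
    have hs : 0 < s := hs
    simp only
    rw [extendZero_of_pos _ hs, opA_eq h0, toReal_laplace, ← mul_assoc, ← Real.rpow_add hs,
      neg_add_cancel, Real.rpow_zero, one_mul]
  · rw [opA_eq h0, opA_eq h0, hst, Real.mul_rpow s.2.le hr.le, mul_assoc]
    conv_rhs => rw [lsMeasure_powMul_eq_smul_map hr hρ hp, laplace_smul_map_mul,
      ENNReal.toReal_mul, ENNReal.toReal_ofReal (by positivity)]

end

lemma opA_injOn {r ρ : ℝ} (hρ : 0 < ρ) : InjOn (opA ρ) (classP r ρ) := by
  intro p hp p' hp' h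
  have h0 := lsMeasure_powMul_Iio_zero hρ hp
  have h0' := lsMeasure_powMul_Iio_zero hρ hp'
  have hμ : lsMeasure (powMul ρ p) = lsMeasure (powMul ρ p') := by
    refine ext_of_laplace_eq h0 h0' (s₀ := 0)
      (fun s hs => laplace_lsMeasure_powMul_ne_top hρ hp hs) fun s hs => ?_
    have hs' := congrFun h ⟨s, hs⟩
    rw [opA_eq h0, opA_eq h0'] at hs'
    exact (ENNReal.toReal_eq_toReal_iff' (laplace_lsMeasure_powMul_ne_top hρ hp hs)
      (laplace_lsMeasure_powMul_ne_top hρ hp' hs)).1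
      (mul_left_cancel₀ (Real.rpow_pos_of_pos hs ρ).ne' hs')
  funext x
  have hx := lsMeasure_powMul_Iic hρ hp x
  have hxρ := Real.rpow_pos_of_pos x.2 ρ
  rw [hμ, lsMeasure_powMul_Iic hρ hp', powMul_of_pos _ _ x.2, powMul_of_pos _ _ x.2,
    ENNReal.ofReal_eq_ofReal_iff (mul_pos hxρ (hp'.1.pos _)).le (mul_pos hxρ (hp.1.pos _)).le] at hx
  exact (mul_left_cancel₀ hxρ.ne' hx).symm

/-! ### Surjectivity -/

/-- A completely monotone `f` with `f (s * r) = r ^ (-ρ) * f s` is the Laplace transform of a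
measure on `[0, ∞)` that is homogeneous under multiplication by `r`. -/
lemma CompletelyMonotone.exists_homogeneous_laplace_eq {r ρ : ℝ} (hr : 1 < r) {f : ℝ → ℝ}
    (hf : CompletelyMonotone f) (hscale : ∀ s, 0 < s → f (s * r) = r ^ (-ρ) * f s) :
    ∃ μ : Measure ℝ, μ (Iio 0) = 0 ∧ (∀ s, 0 < s → laplace μ s = ENNReal.ofReal (f s)) ∧
      μ = ENNReal.ofReal (r ^ ρ) • μ.map (· * r) := by
  have hr0 : 0 < r := one_pos.trans hr
  obtain ⟨μ, hμ, hL⟩ := hf.exists_laplace_eq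
  have hpre : (· * r) ⁻¹' Iio 0 = Iio (0 : ℝ) := by
    ext y; simp [hr0]
  have hstep (s : ℝ) (hs : 0 < s) (h : laplace μ (s * r) = ENNReal.ofReal (f (s * r))) :
      ENNReal.ofReal (r ^ ρ) * laplace μ (s * r) = ENNReal.ofReal (f s) := by
    rw [h, ← ENNReal.ofReal_mul (by positivity), hscale s hs, ← mul_assoc, ← Real.rpow_add hr0,
      add_neg_cancel, Real.rpow_zero, one_mul]
  -- Both sides have transform `f` on `(1, ∞)`, since `s > 1` implies `s * r > 1`; uniqueness near
  -- infinity suffices.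
  have hhom : μ = ENNReal.ofReal (r ^ ρ) • μ.map (· * r) := by
    refine ext_of_laplace_eq hμ ?_ (s₀ := 1) (fun s hs => ?_) fun s hs => ?_
    · rw [Measure.smul_apply, Measure.map_apply (by fun_prop) measurableSet_Iio, hpre, hμ,
        smul_zero]
    · rw [hL s hs]
      exact ENNReal.ofReal_ne_top
    · rw [laplace_smul_map_mul, hstep s (one_pos.trans hs) (hL _ (by nlinarith)), hL s hs]
  -- Homogeneity expresses the transform at `s` through that at `s * r`, so each step extends the
  -- domain downwards by a factor `r`.
  have hall (n : ℕ) : ∀ s, 0 < s → 1 < s * r ^ n → laplace μ s = ENNReal.ofReal (f s) := by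
    induction n with
    | zero => exact fun s _ h => hL s (by simpa using h)
    | succ n ih =>
      intro s hs h
      have h1 := ih (s * r) (by positivity) (by rwa [mul_assoc, ← pow_succ'])
      rw [hhom, laplace_smul_map_mul, hstep s hs h1]
  refine ⟨μ, hμ, fun s hs => ?_, hhom⟩
  obtain ⟨n, hn⟩ := pow_unbounded_of_one_lt s⁻¹ hr
  exact hall n s hs (by rwa [inv_lt_iff_one_lt_mul₀' hs] at hn)

lemma measure_Iic_ne_top_of_laplace_ne_top {μ : Measure ℝ} {s : ℝ} (hs : 0 ≤ s)
    (h : laplace μ s ≠ ⊤) (x : ℝ) : μ (Iic x) ≠ ⊤ := by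
  have hle : ENNReal.ofReal (Real.exp (-s * x)) * μ (Iic x) ≤ laplace μ s := by
    rw [← lintegral_indicator_const measurableSet_Iic]
    refine lintegral_mono fun y => ?_
    refine indicator_le (fun y hy => ENNReal.ofReal_le_ofReal (Real.exp_le_exp.2 ?_)) y
    have : y ≤ x := hy
    nlinarith
  intro htop
  rw [htop, ENNReal.mul_top (by simp [Real.exp_pos])] at hle
  exact h (top_le_iff.1 hle)

lemma continuousWithinAt_toReal_measure_Iic {μ : Measure ℝ} (hfin : ∀ x, μ (Iic x) ≠ ⊤) (x : ℝ) :
    ContinuousWithinAt (fun y => (μ (Iic y)).toReal) (Ici x) x := by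
  rw [← continuousWithinAt_Ioi_iff_Ici]
  have h := tendsto_measure_biInter_gt (μ := μ) (s := fun y : ℝ => Iic y) (a := x)
    (fun _ _ => measurableSet_Iic.nullMeasurableSet) (fun _ _ _ hij => Iic_subset_Iic.2 hij)
    ⟨x + 1, by simp, hfin _⟩
  have hI : ⋂ y, ⋂ (_ : y > x), Iic y = Iic x := by
    ext z
    simpa using ⟨le_of_forall_gt_imp_ge_of_dense, fun hz y hy => hz.trans hy.le⟩
  rw [hI] at h
  exact (ENNReal.tendsto_toReal (hfin x)).comp h

section

variable {r ρ : ℝ} {G : ℝ → ℝ}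

lemma apply_zpow_of_homogeneous (hr : 0 < r) (hG : ∀ x, G (x * r) = r ^ ρ * G x) (n : ℤ) :
    G (r ^ n) = (r ^ n) ^ ρ * G 1 := by
  have hrn (n : ℤ) : 0 < r ^ n := zpow_pos hr n
  induction n using Int.induction_on with
  | zero => simp
  | succ n ih =>
    rw [zpow_add_one₀ hr.ne', hG, ih, Real.mul_rpow (hrn _).le hr.le]
    ring
  | pred n ih =>
    refine mul_left_cancel₀ (Real.rpow_pos_of_pos hr ρ).ne' ?_
    rw [← hG, ← mul_assoc, ← Real.mul_rpow hr.le (hrn _).le, mul_comm r, ← zpow_add_one₀ hr.ne',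
      sub_add_cancel, ih]

/-- Trap `x` between `r ^ n` and `r ^ (n + 1)`, where homogeneity gives `G` exactly; monotonicity
costs at most a factor `r ^ ρ` either way. -/
lemma bounds_of_homogeneous (hr : 1 < r) (hρ : 0 < ρ) (hmono : Monotone G) (h1 : 0 ≤ G 1)
    (hG : ∀ x, G (x * r) = r ^ ρ * G x) {x : ℝ} (hx : 0 < x) :
    r ^ (-ρ) * G 1 ≤ x ^ (-ρ) * G x ∧ x ^ (-ρ) * G x ≤ r ^ ρ * G 1 := by
  have hr0 : 0 < r := one_pos.trans hr
  obtain ⟨n, hn⟩ := exists_mem_Ico_zpow hx hr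
  have hrn : 0 < r ^ n := zpow_pos hr0 n
  have hxρ := Real.rpow_pos_of_pos hx ρ
  rw [zpow_add_one₀ hr0.ne'] at hn
  have hle : (r ^ n) ^ ρ ≤ x ^ ρ := Real.rpow_le_rpow hrn.le hn.1 hρ.le
  have hge : x ^ ρ ≤ (r ^ n) ^ ρ * r ^ ρ := by
    rw [← Real.mul_rpow hrn.le hr0.le]
    exact Real.rpow_le_rpow hx.le hn.2.le hρ.le
  have hlow := hmono hn.1
  have hup := hmono hn.2.le
  rw [hG] at hup
  rw [apply_zpow_of_homogeneous hr0 hG] at hlow hup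
  rw [Real.rpow_neg hx.le, Real.rpow_neg hr0.le, inv_mul_le_iff₀ (Real.rpow_pos_of_pos hr0 ρ),
    inv_mul_le_iff₀ hxρ, ← mul_assoc, mul_comm (r ^ ρ), mul_assoc, ← div_eq_inv_mul,
    le_div_iff₀' hxρ]
  constructor
  · nlinarith [mul_le_mul_of_nonneg_right hge h1, Real.rpow_pos_of_pos hr0 ρ]
  · nlinarith [mul_le_mul_of_nonneg_right hle (mul_nonneg (Real.rpow_pos_of_pos hr0 ρ).le h1)]

lemma mem_classP_of_homogeneous (hr : 1 < r) (hρ : 0 < ρ) (hmono : Monotone G) (h1 : 0 < G 1)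
    (hG : ∀ x, G (x * r) = r ^ ρ * G x) (hrc : ∀ x, ContinuousWithinAt G (Ici x) x) :
    (fun x : PosReal => (x : ℝ) ^ (-ρ) * G x) ∈ classP r ρ := by
  have hr0 : 0 < r := one_pos.trans hr
  have hb := fun x : PosReal => bounds_of_homogeneous hr hρ hmono h1.le hG x.2
  have hc : 0 < r ^ (-ρ) * G 1 := by positivity
  refine ⟨⟨fun x => hc.trans_le (hb x).1, ⟨_, hc, fun x _ => (hb x).1⟩, ⟨_, fun x => (hb x).2⟩,
    fun x => ?_, fun x y hxy => ?_⟩, fun _ => ?_, fun h => absurd h hρ.not_gt⟩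
  · refine ContinuousWithinAt.mul ?_ ?_
    · exact ((Real.continuousAt_rpow_const (x : ℝ) (-ρ) (Or.inl x.2.ne')).comp
        continuous_subtype_val.continuousAt).continuousWithinAt
    · exact (hrc x).comp continuous_subtype_val.continuousWithinAt fun _ hy => hy
  · rw [hxy, hG, Real.mul_rpow x.2.le hr0.le, Real.rpow_neg hr0.le]
    field_simp
  · intro x y hxy
    simp only
    rw [← mul_assoc, ← mul_assoc, ← Real.rpow_add x.2, ← Real.rpow_add y.2]
    simpa using hmono hxy

end

lemma opA_surjOn {r ρ : ℝ} (hr : 1 < r) (hρ : 0 < ρ) :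
    SurjOn (opA ρ) (classP r ρ) (classQ r ρ) := by
  rintro q ⟨hq0, hqcm, hqper⟩
  have hr0 : 0 < r := one_pos.trans hr
  obtain ⟨μ, hμ, hL, hhom⟩ := hqcm.exists_homogeneous_laplace_eq (ρ := ρ) hr fun s hs => by
    rw [extendZero_of_pos q hs, extendZero_of_pos q (mul_pos hs hr0),
      hqper ⟨s, hs⟩ ⟨s * r, mul_pos hs hr0⟩ rfl, Real.mul_rpow hs.le hr0.le]
    ring
  have hfin (x : ℝ) : μ (Iic x) ≠ ⊤ :=
    measure_Iic_ne_top_of_laplace_ne_top zero_le_one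
      (hL 1 one_pos ▸ ENNReal.ofReal_ne_top) x
  set G : ℝ → ℝ := fun x => (μ (Iic x)).toReal with hGdef
  have hmono : Monotone G := fun x y hxy =>
    ENNReal.toReal_mono (hfin y) (measure_mono (Iic_subset_Iic.2 hxy))
  have hrc : ∀ x, ContinuousWithinAt G (Ici x) x := continuousWithinAt_toReal_measure_Iic hfin
  have hG (x : ℝ) : G (x * r) = r ^ ρ * G x := by
    have hpre : (· * r) ⁻¹' Iic (x * r) = Iic x := by
      ext y; exact mul_le_mul_iff_left₀ hr0
    simp only [hGdef]
    conv_lhs => rw [hhom, Measure.smul_apply, Measure.map_apply (by fun_prop) measurableSet_Iic,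
      hpre, smul_eq_mul, ENNReal.toReal_mul, ENNReal.toReal_ofReal (by positivity)]
  have hG0 : ∀ x ≤ 0, G x = 0 := by
    -- Homogeneity at the fixed point `0` reads `G 0 = r ^ ρ * G 0` with `r ^ ρ > 1`.
    have h0 : G 0 = 0 := by
      have h := hG 0
      rw [zero_mul] at h
      have := Real.one_lt_rpow hr hρ
      nlinarith
    exact fun x hx => le_antisymm (h0 ▸ hmono hx) ENNReal.toReal_nonneg
  have hlift (x : ℝ) : ENNReal.ofReal (G x) = μ (Iic x) := ENNReal.ofReal_toReal (hfin x)
  have hμls : lsMeasure G = μ := by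
    refine (ext_of_measure_Iic_eq hfin fun x => ?_).symm
    rw [lsMeasure_Iic hmono hrc hG0, hlift]
  -- If `G 1 = 0`, the two-sided bounds force `μ = 0`, contradicting `q 1 > 0`.
  have h1 : 0 < G 1 := by
    refine lt_of_le_of_ne ENNReal.toReal_nonneg fun h => ?_
    have hz : μ = 0 := by
      refine ext_of_measure_Iic_eq hfin fun x => ?_
      rw [← hlift, Measure.coe_zero, Pi.zero_apply]
      rcases le_or_gt x 0 with hx | hx
      · rw [hG0 x hx, ENNReal.ofReal_zero]
      · have hb := bounds_of_homogeneous hr hρ hmono h.le hG hx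
        rw [← h, mul_zero, mul_zero] at hb
        have hx0 := (mul_eq_zero.1 (le_antisymm hb.2 hb.1)).resolve_left
          (Real.rpow_pos_of_pos hx _).ne'
        rw [hx0, ENNReal.ofReal_zero]
    have hl := hL 1 one_pos
    rw [hz, laplace, lintegral_zero_measure, Real.one_rpow, one_mul,
      extendZero_of_pos q one_pos] at hl
    exact (hq0 _).not_ge (ENNReal.ofReal_eq_zero.1 hl.symm)
  refine ⟨_, mem_classP_of_homogeneous hr hρ hmono h1 hG hrc, ?_⟩
  have hpow : powMul ρ (fun x : PosReal => (x : ℝ) ^ (-ρ) * G x) = G := by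
    funext x
    rcases le_or_gt x 0 with hx | hx
    · rw [powMul_of_nonpos _ _ hx, hG0 x hx]
    · rw [powMul_of_pos _ _ hx, ← mul_assoc, ← Real.rpow_add hx, add_neg_cancel, Real.rpow_zero,
        one_mul]
  funext s
  have hqs : 0 ≤ (s : ℝ) ^ (-ρ) * q s :=
    mul_nonneg (Real.rpow_nonneg s.2.le _) (hq0 s).le
  rw [opA_eq (by rw [hpow, hμls, hμ]), hpow, hμls, hL s s.2, extendZero_of_pos q s.2,
    ENNReal.toReal_ofReal hqs, ← mul_assoc, ← Real.rpow_add s.2, add_neg_cancel, Real.rpow_zero,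
    one_mul]

end LogPeriodic

theorem lemma2p3 (r ρ : ℝ) (hr : 1 < r) (hρ : 0 < ρ) :
    (∀ p ∈ LogPeriodic.classP r ρ, ∀ s : ℝ, 0 < s →
      IntegrableOn (fun x : ℝ => Real.exp (-s * x)) (Ici 0)
        (LogPeriodic.lsMeasure (LogPeriodic.powMul ρ p))) ∧
    BijOn (LogPeriodic.opA ρ) (LogPeriodic.classP r ρ) (LogPeriodic.classQ r ρ) :=
  ⟨fun _ hp _ hs => (LogPeriodic.integrable_exp_of_laplace_ne_top
      (LogPeriodic.laplace_lsMeasure_powMul_ne_top hρ hp hs)).integrableOn,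
    fun _ hp => LogPeriodic.opA_mem_classQ (one_pos.trans hr) hρ hp,
    LogPeriodic.opA_injOn hρ, LogPeriodic.opA_surjOn hr hρ⟩
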